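/- Setting. Let $\mathcal X=P\cap(\mathbb Z^k\times\mathbb R^{n-k})\neq\emptyset$ with $P\subseteq\mathbb R^n$ a polytope and $0\le k\le n$, let $\emptyset\neq\mathcal U\subseteq\mathbb R^m$, and let $f_1,f_2$ be real-valued functions on $\mathcal X\times\mathcal U$ such that $f_i(\cdot,\xi)$ is linear on $\mathcal X$ for every $\xi\in\mathcal U$. Assume that either $\mathcal U$ is finite, or $\mathcal U$ is a polytope and $f_i(x,\cdot)$ is continuous and quasi-convex on $\mathcal U$ for all $x\in\mathcal X$, $i=1,2$. Put $f_i^{\mathcal U}(x)=\sup_{\xi\in\mathcal U}f_i(x,\xi)$ and $f^{\mathcal U}=(f_1^{\mathcal U},f_2^{\mathcal U})$, and consider $\mathrm{BRO}(\mathcal U)$: $\min_{x\in\mathcal X}f^{\mathcal U}(x)$, with outcome set $\mathcal Y=f^{\mathcal U}(\mathcal X)$. Vectors are compared componentwise. A point $y\in\mathcal Y$ is nondominated if no $y'\in\mathcal Y\setminus\{y\}$ satisfies $y'\le y$. A nondominated point $y$ is extreme supported (resp. supported) nondominated if no convex combination $z$ of nondominated points other than $y$ satisfies $z\le y$ (resp.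 $z_i<y_i$ for $i=1,2$). Let $\mathcal Y_{\mathrm{ESN}}$ be the set of extreme supported nondominated points. A solution $x\in\mathcal X$ is supported efficient if $f^{\mathcal U}(x)$ is supported nondominated, and a set $R\subseteq\mathcal X$ is a representative set of extreme supported efficient solutions if $f^{\mathcal U}(R)=\mathcal Y_{\mathrm{ESN}}$. Optimization-pessimization for $\min_{x\in X'}\sup_{\xi\in U'}h(x,\xi)$ with finite initial set $V\subseteq U'$. Repeat: choose $x\in\arg\min_{x\in X'}\max_{\xi\in V}h(x,\xi)$; choose $\xi^*\in\arg\max_{\xi\in U'}h(x,\xi)$; let $z=\max_{\xi\in V}h(x,\xi)$; add $\xi^*$ to $V$; stop and return $x$, the value $z$ and the set $V$ if $\max_{\xi\in U'}h(x,\xi)=z$. Algorithm MOA. Let $\mathcal U^{(0)}\subseteq\mathcal U$ and $\mathcal W^{(0)}\subseteq\mathcal U\times\mathcal U$ (for instance $\mathcal W^{(0)}=\mathcal U^{(0)}\times\mathcal U^{(0)}$) be nonempty finite initial scenario sets. All minimizations below are carried out by optimization-pessimization. 1. Compute $\epsilon_1=\min_{x\in\mathcal X}f_1^{\mathcal U}(x)$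 with initial set $\mathcal U^{(0)}$. Then compute a minimizer $x^L$ of $f_2^{\mathcal U}$ over $\{x\in\mathcal X: f_1^{\mathcal U}(x)\le\epsilon_1\}$, starting with the scenario set returned by the previous call. Likewise compute $\epsilon_2=\min_{x\in\mathcal X}f_2^{\mathcal U}(x)$ with initial set $\mathcal U^{(0)}$, and then a minimizer $x^R$ of $f_1^{\mathcal U}$ over $\{x\in\mathcal X: f_2^{\mathcal U}(x)\le\epsilon_2\}$, starting with the scenario set returned by the previous call. Put $y^L=f^{\mathcal U}(x^L)$ and $y^R=f^{\mathcal U}(x^R)$. 2. If $y^L=y^R$, return $X^*=\{x^L\}$, $Y^*=\{y^L\}$. Otherwise set $X^*=\{x^L,x^R\}$, $Y^*=\{y^L,y^R\}$ and let the list $\mathcal L$ consist of the pair $(y^L,y^R)$. 3. While $\mathcal L\neq\emptyset$: remove some pair $(y^l,y^r)$ from $\mathcal L$ and put $\lambda=(y^l_2-y^r_2,\;y^r_1-y^l_1)$. Apply optimization-pessimization over the product uncertainty set $\mathcal U\times\mathcal U$ to $\bar f_\lambda(x,(\xi_1,\xi_2))=\lambda_1f_1(x,\xi_1)+\lambda_2f_2(x,\xi_2)$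 on $\mathcal X$ with initial set $\mathcal W^{(0)}$, obtaining $x^*$, and put $y^*=f^{\mathcal U}(x^*)$. If $\lambda^{T}y^*\neq\lambda^{T}y^l$, add $x^*$ to $X^*$, $y^*$ to $Y^*$, and $(y^l,y^*)$, $(y^*,y^r)$ to $\mathcal L$. 4. Return $X^*$ and $Y^*$. Claim. Whatever choices are made among optimal solutions, among worst-case scenarios and among the pairs in $\mathcal L$, every step of MOA can be carried out, and MOA stops after finitely many iterations in total (those inside all calls of optimization-pessimization included). The returned set $X^*\subseteq\mathcal X$ is finite, $f^{\mathcal U}(X^*)=Y^*$, every element of $X^*$ is supported efficient, $\mathcal Y_{\mathrm{ESN}}\subseteq Y^*$, and $X^*$ contains a representative set of extreme supported efficient solutions. More precisely, removing from $X^*$ every $x$ for which some convex combination of points of $Y^*\setminus\{f^{\mathcal U}(x)\}$ is componentwise at most $f^{\mathcal U}(x)$ leaves exactly a representative set of extreme supported efficient solutions of $\mathrm{BRO}(\mathcal U)$. -/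

import Mathlib

/-! ### Pareto notions for a set of outcome vectors in `ℝ²` (componentwise order) -/

/-- Outcome vectors; index `0` is the first objective, index `1` the second. -/
abbrev Outcome := Fin 2 → ℝ

/-- The nondominated points of `Y`: no other point of `Y` is componentwise at most `y`. -/
def nondominated (Y : Set Outcome) : Set Outcome :=
  {y | y ∈ Y ∧ ¬ ∃ y' ∈ Y, y' ≤ y ∧ y' ≠ y}

/-- Extreme supported nondominated points: no convex combination of *other* nondominated points is
componentwise at most `y`. -/
def extremeSupportedNondominated (Y : Set Outcome) : Set Outcome :=
  {y | y ∈ nondominated Y ∧ ¬ ∃ z ∈ convexHull ℝ (nondominated Y \ {y}), z ≤ y}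

/-- Supported nondominated points: no convex combination of other nondominated points is strictly
smaller than `y` in every component. -/
def supportedNondominated (Y : Set Outcome) : Set Outcome :=
  {y | y ∈ nondominated Y ∧ ¬ ∃ z ∈ convexHull ℝ (nondominated Y \ {y}), ∀ i, z i < y i}

/-- `x` is a supported efficient solution of `min_{x ∈ X} g x`. -/
def IsSupportedEfficient {E : Type*} (X : Set E) (g : E → Outcome) (x : E) : Prop :=
  x ∈ X ∧ g x ∈ supportedNondominated (g '' X)

/-- `R` is a representative set of extreme supported efficient solutions of `min_{x ∈ X} g x`. -/
def IsRepresentativeESE {E : Type*} (X : Set E) (g : E → Outcome) (R : Set E) : Prop :=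
  R ⊆ X ∧ g '' R = extremeSupportedNondominated (g '' X)

/-- The part of a set `A` of solutions that remains after removing every `x ∈ A` whose image is
componentwise at least some convex combination of the other images of elements of `A`. -/
def extremePart {E : Type*} (g : E → Outcome) (A : Set E) : Set E :=
  {x | x ∈ A ∧ ¬ ∃ z ∈ convexHull ℝ (g '' A \ {g x}), z ≤ g x}

/-! ### Biobjective mixed-integer linear robust optimization -/

/-- A polytope given by inequalities: a bounded intersection of finitely many half-spaces. -/
def IsBoundedPolyhedron {n : ℕ} (P : Set (Fin n → ℝ)) : Prop :=
  Bornology.IsBounded P ∧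
    ∃ (r : ℕ) (A : Matrix (Fin r) (Fin n) ℝ) (b : Fin r → ℝ), P = {x | A.mulVec x ≤ b}

/-- A polytope given by points: the convex hull of finitely many points. -/
def IsHullOfFinite {m : ℕ} (U : Set (Fin m → ℝ)) : Prop :=
  ∃ t : Finset (Fin m → ℝ), U = convexHull ℝ (t : Set (Fin m → ℝ))

/-- The worst-case value `sup_{ξ ∈ V} h x ξ`. -/
noncomputable def worst {E S : Type*} (h : E → S → ℝ) (V : Set S) (x : E) : ℝ :=
  sSup (h x '' V)

/-- The data of an uncertain biobjective problem; only the values `f i x ξ` with `x` feasible and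
`ξ ∈ U` matter. -/
structure BROData (n m : ℕ) where
  /-- the set `P` cutting out the continuous relaxation of the feasible set -/
  P : Set (Fin n → ℝ)
  /-- the number of integer variables (the first `k` ones) -/
  k : ℕ
  /-- the uncertainty set -/
  U : Set (Fin m → ℝ)
  /-- the two objective functions -/
  f : Fin 2 → (Fin n → ℝ) → (Fin m → ℝ) → ℝ

namespace BROData

variable {n m : ℕ}

/-- The feasible set `P ∩ (ℤ^k × ℝ^(n-k))`. -/
def X (B : BROData n m) : Set (Fin n → ℝ) :=
  {x | x ∈ B.P ∧ ∀ j : Fin n, (j : ℕ) < B.k → ∃ z : ℤ, x j = z}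

/-- The worst-case objective vector `f^U(x)`. -/
noncomputable def F (B : BROData n m) (x : Fin n → ℝ) : Outcome :=
  fun i => worst (B.f i) B.U x

/-- The standing assumptions on a biobjective mixed-integer linear robust problem. For a finite
uncertainty set no condition on the dependence on `ξ` is needed. -/
structure IsBRO (B : BROData n m) : Prop where
  k_le : B.k ≤ n
  polytope : IsBoundedPolyhedron B.P
  feasible : B.X.Nonempty
  scenario : B.U.Nonempty
  linear : ∀ i, ∀ ξ ∈ B.U, ∃ c : Fin n → ℝ, ∀ x ∈ B.X, B.f i x ξ = c ⬝ᵥ x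
  uncertainty : B.U.Finite ∨
    (IsHullOfFinite B.U ∧
      ∀ i, ∀ x ∈ B.X, ContinuousOn (B.f i x) B.U ∧ QuasiconvexOn ℝ B.U (B.f i x))

end BROData

/-! ### Optimization-pessimization for `min_{x ∈ X} sup_{ξ ∈ U} h x ξ` -/

/-- One pass through the loop body, with current scenario set `V`: `x` is a feasible solution
minimizing the worst case over `V` (optimization), and `ξ ∈ U` is a worst-case scenario for `x`
(pessimization). Both are arbitrary choices among the optimal ones. -/
def OptPessIter {E S : Type*} (X : Set E) (h : E → S → ℝ) (U V : Set S) (x : E) (ξ : S) : Prop :=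
  (x ∈ X ∧ ∀ x' ∈ X, worst h V x ≤ worst h V x') ∧ (ξ ∈ U ∧ ∀ ξ' ∈ U, h x ξ' ≤ h x ξ)

/-- A pass after which the loop goes on, with the new scenario set `V'`. -/
def OptPessContinue {E S : Type*} (X : Set E) (h : E → S → ℝ) (U V V' : Set S) : Prop :=
  ∃ x ξ, OptPessIter X h U V x ξ ∧ worst h U x ≠ worst h V x ∧ V' = insert ξ V

/-- A pass after which the loop stops because upper and lower bound coincide; `x` is the returned
solution and `V'` the returned scenario set. -/
def OptPessReturn {E S : Type*} (X : Set E) (h : E → S → ℝ) (U V : Set S) (x : E)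
    (V' : Set S) : Prop :=
  ∃ ξ, OptPessIter X h U V x ξ ∧ worst h U x = worst h V x ∧ V' = insert ξ V

/-! ### The multiobjective optimizer's approach, as a transition system -/

/-- States of the algorithm. `V` is always the current scenario set of the running call of
optimization-pessimization. -/
inductive MOAState (n m : ℕ) : Type
  /-- computing `ε₁ = min f₁^U` -/
  | minFirst (V : Set (Fin m → ℝ))
  /-- computing `x^L`, minimizing `f₂^U` subject to `f₁^U ≤ ε₁` -/
  | lexFirst (ε₁ : ℝ) (V : Set (Fin m → ℝ))
  /-- computing `ε₂ = min f₂^U` -/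
  | minSecond (xL : Fin n → ℝ) (V : Set (Fin m → ℝ))
  /-- computing `x^R`, minimizing `f₁^U` subject to `f₂^U ≤ ε₂` -/
  | lexSecond (xL : Fin n → ℝ) (ε₂ : ℝ) (V : Set (Fin m → ℝ))
  /-- head of the main loop, with the found solutions, the found points and the pending pairs -/
  | loop (Xs : Set (Fin n → ℝ)) (Ys : Set Outcome) (L : Multiset (Outcome × Outcome))
  /-- solving the weighted-sum problem of the pair `(yl, yr)` -/
  | weighted (Xs : Set (Fin n → ℝ)) (Ys : Set Outcome) (L : Multiset (Outcome × Outcome))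
      (yl yr : Outcome) (V : Set ((Fin m → ℝ) × (Fin m → ℝ)))
  /-- finished, returning `Xs` and `Ys` -/
  | done (Xs : Set (Fin n → ℝ)) (Ys : Set Outcome)

namespace BROData

variable {n m : ℕ}

/-- The feasible set of a lexicographic subproblem: `{x ∈ X | f_i^U(x) ≤ ε}`. -/
def restricted (B : BROData n m) (i : Fin 2) (ε : ℝ) : Set (Fin n → ℝ) :=
  {x | x ∈ B.X ∧ B.F x i ≤ ε}

/-- The scalarized objective `λ₁ f₁(x, ξ₁) + λ₂ f₂(x, ξ₂)` on the product uncertainty set. -/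
def scalarized (B : BROData n m) (w : Outcome) (x : Fin n → ℝ)
    (ξ : (Fin m → ℝ) × (Fin m → ℝ)) : ℝ :=
  w 0 * B.f 0 x ξ.1 + w 1 * B.f 1 x ξ.2

/-- The weights `λ = (y^l₂ - y^r₂, y^r₁ - y^l₁)` of a pair of outcome vectors. -/
def weights (yl yr : Outcome) : Outcome := ![yl 1 - yr 1, yr 0 - yl 0]

/-- One step of the algorithm: one iteration of a running call of optimization-pessimization
(together with the assignments that follow it if the call returns), or one control step of the main
loop. `U₀` and `W₀` are the initial scenario sets for the calls over `U` and over `U × U`. -/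
inductive MOAStep (B : BROData n m) (U₀ : Set (Fin m → ℝ))
    (W₀ : Set ((Fin m → ℝ) × (Fin m → ℝ))) : MOAState n m → MOAState n m → Prop
  | minFirst_continue {V V'} (h : OptPessContinue B.X (B.f 0) B.U V V') :
      MOAStep B U₀ W₀ (.minFirst V) (.minFirst V')
  | minFirst_return {V V' x} (h : OptPessReturn B.X (B.f 0) B.U V x V') :
      MOAStep B U₀ W₀ (.minFirst V) (.lexFirst (B.F x 0) V')
  | lexFirst_continue {ε₁ V V'}
      (h : OptPessContinue (B.restricted 0 ε₁) (B.f 1) B.U V V') :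
      MOAStep B U₀ W₀ (.lexFirst ε₁ V) (.lexFirst ε₁ V')
  | lexFirst_return {ε₁ V V' xL}
      (h : OptPessReturn (B.restricted 0 ε₁) (B.f 1) B.U V xL V') :
      MOAStep B U₀ W₀ (.lexFirst ε₁ V) (.minSecond xL U₀)
  | minSecond_continue {xL V V'} (h : OptPessContinue B.X (B.f 1) B.U V V') :
      MOAStep B U₀ W₀ (.minSecond xL V) (.minSecond xL V')
  | minSecond_return {xL V V' x} (h : OptPessReturn B.X (B.f 1) B.U V x V') :
      MOAStep B U₀ W₀ (.minSecond xL V) (.lexSecond xL (B.F x 1) V')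
  | lexSecond_continue {xL ε₂ V V'}
      (h : OptPessContinue (B.restricted 1 ε₂) (B.f 0) B.U V V') :
      MOAStep B U₀ W₀ (.lexSecond xL ε₂ V) (.lexSecond xL ε₂ V')
  | lexSecond_return_eq {xL ε₂ V V' xR}
      (h : OptPessReturn (B.restricted 1 ε₂) (B.f 0) B.U V xR V') (heq : B.F xL = B.F xR) :
      MOAStep B U₀ W₀ (.lexSecond xL ε₂ V) (.done {xL} {B.F xL})
  | lexSecond_return_ne {xL ε₂ V V' xR}
      (h : OptPessReturn (B.restricted 1 ε₂) (B.f 0) B.U V xR V') (hne : B.F xL ≠ B.F xR) :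
      MOAStep B U₀ W₀ (.lexSecond xL ε₂ V) (.loop {xL, xR} {B.F xL, B.F xR} {(B.F xL, B.F xR)})
  | loop_remove {Xs Ys L yl yr} :
      MOAStep B U₀ W₀ (.loop Xs Ys ((yl, yr) ::ₘ L)) (.weighted Xs Ys L yl yr W₀)
  | weighted_continue {Xs Ys L yl yr V V'}
      (h : OptPessContinue B.X (B.scalarized (weights yl yr)) (B.U ×ˢ B.U) V V') :
      MOAStep B U₀ W₀ (.weighted Xs Ys L yl yr V) (.weighted Xs Ys L yl yr V')
  | weighted_return_new {Xs Ys L yl yr V V' x}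
      (h : OptPessReturn B.X (B.scalarized (weights yl yr)) (B.U ×ˢ B.U) V x V')
      (hne : weights yl yr ⬝ᵥ B.F x ≠ weights yl yr ⬝ᵥ yl) :
      MOAStep B U₀ W₀ (.weighted Xs Ys L yl yr V)
        (.loop (insert x Xs) (insert (B.F x) Ys) ((yl, B.F x) ::ₘ (B.F x, yr) ::ₘ L))
  | weighted_return_old {Xs Ys L yl yr V V' x}
      (h : OptPessReturn B.X (B.scalarized (weights yl yr)) (B.U ×ˢ B.U) V x V')
      (heq : weights yl yr ⬝ᵥ B.F x = weights yl yr ⬝ᵥ yl) :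
      MOAStep B U₀ W₀ (.weighted Xs Ys L yl yr V) (.loop Xs Ys L)
  | loop_exit {Xs Ys} :
      MOAStep B U₀ W₀ (.loop Xs Ys 0) (.done Xs Ys)

end BROData

/-! Everything rests on a finite partition of the feasible set into cells. Some finite `T ⊆ U`
contains, for each objective and each feasible point, a worst-case scenario: all of `U`, or, by
quasi-convexity, the points spanning `U`. A cell records the tight inequalities, the integer
coordinates and, per objective, the worst-case scenarios in `T`. If `x` and `x'` share a cell, the
segment from `x'` to `x` can be prolonged a little beyond `x` within the feasible set, and `F` is
affine along it (`exists_cell`).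

Hence an affine inequality that holds up to the prolonged end and is tight at `x` is reversed at
`x'`. Applied to a scenario, this makes a worst case at `x` a worst case on the whole cell
(`eq_worst_of_cell_eq`), even for scenarios outside `T`, so each unfinished iteration covers a new
cell. Applied to a weighted sum, it makes `x'` optimal whenever `x` is, so each newly found solution
lies in an unused cell (`cell_notMem`). A lexicographic rank then excludes infinite runs.

For correctness, the main loop keeps every nondominated point either above the convex hull of the
found points or inside the gap of a pending pair. Once no pair is pending, the found points generate
the whole lower boundary, and a separating functional transfers extremality among them to
extremality among all nondominated points (`mem_extremeSupportedNondominated`). -/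

open Filter Topology

/-! ### Worst cases and a single call of optimization-pessimization -/

section Worst

variable {E S : Type*} {h : E → S → ℝ} {U V : Set S} {x : E}

theorem worst_eq_of_isMax {ξ : S} (hξ : ξ ∈ V) (hmax : ∀ ξ' ∈ V, h x ξ' ≤ h x ξ) :
    worst h V x = h x ξ :=
  IsGreatest.csSup_eq ⟨⟨ξ, hξ, rfl⟩, by rintro _ ⟨ξ', hξ', rfl⟩; exact hmax ξ' hξ'⟩

theorem le_worst (hmax : ∃ ξ ∈ V, ∀ ξ' ∈ V, h x ξ' ≤ h x ξ) {ξ : S} (hξ : ξ ∈ V) :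
    h x ξ ≤ worst h V x := by
  obtain ⟨ζ, hζ, hm⟩ := hmax
  rw [worst_eq_of_isMax hζ hm]
  exact hm ξ hξ

theorem Set.Finite.exists_isMax_scenario (hV : V.Finite) (hne : V.Nonempty) (h : E → S → ℝ)
    (x : E) : ∃ ξ ∈ V, ∀ ξ' ∈ V, h x ξ' ≤ h x ξ :=
  V.exists_max_image (h x) hV hne

theorem worst_le_worst (hV : V.Finite) (hne : V.Nonempty) (hVU : V ⊆ U)
    (hmax : ∃ ξ ∈ U, ∀ ξ' ∈ U, h x ξ' ≤ h x ξ) : worst h V x ≤ worst h U x := by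
  obtain ⟨ξ, hξ, hm⟩ := hV.exists_isMax_scenario hne h x
  rw [worst_eq_of_isMax hξ hm]
  exact le_worst hmax (hVU hξ)

theorem worst_le_iff (hmax : ∃ ξ ∈ V, ∀ ξ' ∈ V, h x ξ' ≤ h x ξ) {a : ℝ} :
    worst h V x ≤ a ↔ ∀ ξ ∈ V, h x ξ ≤ a := by
  obtain ⟨ζ, hζ, hm⟩ := hmax
  rw [worst_eq_of_isMax hζ hm]
  exact ⟨fun ha ξ hξ => (hm ξ hξ).trans ha, fun H => H ζ hζ⟩

theorem exists_isMin_worst [TopologicalSpace E] {X : Set E} (hX : IsCompact X)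
    (hXne : X.Nonempty) (hV : V.Finite) (hne : V.Nonempty)
    (hc : ∀ ξ ∈ V, ContinuousOn (fun x => h x ξ) X) :
    ∃ x ∈ X, ∀ x' ∈ X, worst h V x ≤ worst h V x' := by
  have hne' : hV.toFinset.Nonempty := by simpa using hne
  have heq : worst h V = fun x => hV.toFinset.sup' hne' (h x) := by
    funext x
    obtain ⟨ξ, hξ, hm⟩ := hV.exists_isMax_scenario hne h x
    rw [worst_eq_of_isMax hξ hm]
    exact le_antisymm (Finset.le_sup' (h x) (by simpa using hξ))
      (Finset.sup'_le _ _ fun b hb => hm b (by simpa using hb))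
  have hcont : ContinuousOn (worst h V) X := by
    rw [heq]
    exact ContinuousOn.finset_sup'_apply hne' fun ξ hξ => hc ξ (by simpa using hξ)
  exact hX.exists_isMinOn hXne hcont

end Worst

/-- Nonempty finite sets of scenarios from `U`. -/
structure IsScenarioSet {S : Type*} (U V : Set S) : Prop where
  finite : V.Finite
  nonempty : V.Nonempty
  subset : V ⊆ U

theorem IsScenarioSet.insert {S : Type*} {U V : Set S} (hV : IsScenarioSet U V) {ξ : S}
    (hξ : ξ ∈ U) : IsScenarioSet U (insert ξ V) :=
  ⟨hV.finite.insert ξ, Set.insert_nonempty _ _, Set.insert_subset hξ hV.subset⟩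

/-- A robust problem `min_{x ∈ X} sup_{ξ ∈ U} h x ξ` whose feasible set is divided into finitely
many cells (the fibres of `cell`), so that from each point one can go a bit further in the direction
away from any other point of its cell, with the worst-case value changing linearly. -/
structure IsCellularProblem {n : ℕ} {S κ : Type*} (X : Set (Fin n → ℝ))
    (h : (Fin n → ℝ) → S → ℝ) (U : Set S) (cell : (Fin n → ℝ) → κ) : Prop where
  compact : IsCompact X
  linear : ∀ ξ ∈ U, ∃ c : Fin n → ℝ, ∀ x ∈ X, h x ξ = c ⬝ᵥ x
  exists_max : ∀ x ∈ X, ∃ ξ ∈ U, ∀ ξ' ∈ U, h x ξ' ≤ h x ξ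
  finite : (cell '' X).Finite
  extend : ∀ x ∈ X, ∀ x' ∈ X, cell x = cell x' → ∀ᶠ s : ℝ in 𝓝[>] 0,
    x + s • (x - x') ∈ X ∧
      worst h U (x + s • (x - x')) = worst h U x + s * (worst h U x - worst h U x')

/-- The number of cells on which no scenario of `V` is a worst case throughout. -/
noncomputable def uncovered {E S κ : Type*} (X : Set E) (h : E → S → ℝ) (U : Set S)
    (cell : E → κ) (V : Set S) : ℕ :=
  {σ | σ ∈ cell '' X ∧ ¬ ∃ ξ ∈ V, ∀ x ∈ X, cell x = σ → h x ξ = worst h U x}.ncard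

namespace IsCellularProblem

variable {n : ℕ} {S κ : Type*} {X : Set (Fin n → ℝ)} {h : (Fin n → ℝ) → S → ℝ} {U V V' : Set S}
  {cell : (Fin n → ℝ) → κ}

/-- On the line through `x'` and `x`, the difference between `h · ξ` and the worst case is affine.
It vanishes at `x` and is at most zero just beyond `x`, hence at least zero at `x'`, where it cannot
be positive either. -/
theorem eq_worst_of_cell_eq (hp : IsCellularProblem X h U cell) {x x' : Fin n → ℝ} (hx : x ∈ X)
    (hx' : x' ∈ X) (hcell : cell x = cell x') {ξ : S} (hξ : ξ ∈ U)
    (hmax : ∀ ξ' ∈ U, h x ξ' ≤ h x ξ) : h x' ξ = worst h U x' := by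
  obtain ⟨c, hc⟩ := hp.linear ξ hξ
  obtain ⟨s, ⟨hsX, hsW⟩, hs⟩ := ((hp.extend x hx x' hx' hcell).and self_mem_nhdsWithin).exists
  have hs : 0 < s := hs
  have h1 := le_worst (hp.exists_max _ hsX) hξ
  have h2 := worst_eq_of_isMax hξ hmax
  have h3 := le_worst (hp.exists_max _ hx') hξ
  rw [hsW, hc _ hsX, dotProduct_add, dotProduct_smul, dotProduct_sub, smul_eq_mul, ← hc x hx,
    ← hc x' hx', h2] at h1
  have h4 : 0 ≤ s * (h x' ξ - worst h U x') := by nlinarith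
  have h5 := nonneg_of_mul_nonneg_right h4 hs
  linarith

/-- The new scenario covers the cell of the current solution. No earlier one did, since it would
have made the two bounds coincide and stopped the loop. -/
theorem uncovered_lt (hp : IsCellularProblem X h U cell) (hV : IsScenarioSet U V)
    (hstep : OptPessContinue X h U V V') :
    IsScenarioSet U V' ∧ uncovered X h U cell V' < uncovered X h U cell V := by
  obtain ⟨x, ξ, ⟨⟨hx, -⟩, hξ, hmax⟩, hne, rfl⟩ := hstep
  refine ⟨hV.insert hξ, Set.ncard_lt_ncard ?_ (hp.finite.subset fun σ hσ => hσ.1)⟩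
  refine (Set.ssubset_iff_of_subset ?_).2 ⟨cell x, ⟨⟨x, hx, rfl⟩, ?_⟩, ?_⟩
  · rintro σ ⟨hσ, hno⟩
    exact ⟨hσ, fun ⟨ζ, hζ, H⟩ => hno ⟨ζ, Set.mem_insert_of_mem _ hζ, H⟩⟩
  · rintro ⟨ζ, hζ, H⟩
    refine hne (le_antisymm ?_
      (worst_le_worst hV.finite hV.nonempty hV.subset (hp.exists_max x hx)))
    rw [← H x hx rfl]
    exact le_worst (hV.finite.exists_isMax_scenario hV.nonempty h x) hζ
  · rintro ⟨-, hno⟩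
    exact hno ⟨ξ, Set.mem_insert _ _, fun x' hx' hc =>
      hp.eq_worst_of_cell_eq hx hx' hc.symm hξ hmax⟩

/-- The worst case over `V` is a lower bound for that over `U`, and the stopping test says that this
bound is attained at `x`. -/
theorem isMin_of_return (hp : IsCellularProblem X h U cell) (hV : IsScenarioSet U V)
    {x : Fin n → ℝ} (hret : OptPessReturn X h U V x V') :
    IsScenarioSet U V' ∧ x ∈ X ∧ ∀ x' ∈ X, worst h U x ≤ worst h U x' := by
  obtain ⟨ξ, ⟨⟨hx, hmin⟩, hξ, -⟩, heq, rfl⟩ := hret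
  exact ⟨hV.insert hξ, hx, fun x' hx' => heq ▸ (hmin x' hx').trans
    (worst_le_worst hV.finite hV.nonempty hV.subset (hp.exists_max x' hx'))⟩

theorem continue_or_return (hp : IsCellularProblem X h U cell) (hX : X.Nonempty)
    (hV : IsScenarioSet U V) :
    (∃ V', OptPessContinue X h U V V') ∨ ∃ x V', OptPessReturn X h U V x V' := by
  obtain ⟨x, hx, hmin⟩ := exists_isMin_worst (h := h) hp.compact hX hV.finite hV.nonempty
    fun ξ hξ => by
      obtain ⟨c, hc⟩ := hp.linear ξ (hV.subset hξ)
      exact ContinuousOn.congr (by unfold dotProduct; fun_prop) hc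
  obtain ⟨ξ, hξ, hmax⟩ := hp.exists_max x hx
  by_cases heq : worst h U x = worst h V x
  · exact .inr ⟨x, _, ξ, ⟨⟨hx, hmin⟩, hξ, hmax⟩, heq, rfl⟩
  · exact .inl ⟨_, x, ξ, ⟨⟨hx, hmin⟩, hξ, hmax⟩, heq, rfl⟩

end IsCellularProblem

/-! ### Geometry of supported points in the plane -/

theorem mem_nondominated_eq {Y : Set Outcome} {y y' : Outcome} (hy : y ∈ nondominated Y)
    (hy' : y' ∈ Y) (hle : y' ≤ y) : y' = y :=
  by_contra fun hne => hy.2 ⟨y', hy', hle, hne⟩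

theorem outcome_le_iff {y z : Outcome} : y ≤ z ↔ y 0 ≤ z 0 ∧ y 1 ≤ z 1 := by
  simp [Pi.le_def, Fin.forall_fin_two]

theorem outcome_ext {y z : Outcome} (h0 : y 0 = z 0) (h1 : y 1 = z 1) : y = z := by
  ext i; fin_cases i <;> assumption

theorem weights_dotProduct (yl yr y : Outcome) :
    BROData.weights yl yr ⬝ᵥ y = (yl 1 - yr 1) * y 0 + (yr 0 - yl 0) * y 1 := by
  simp [BROData.weights, dotProduct, Fin.sum_univ_two]

theorem dotProduct_outcome (w y : Outcome) : w ⬝ᵥ y = w 0 * y 0 + w 1 * y 1 := by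
  simp [dotProduct, Fin.sum_univ_two]

/-- Points minimizing a nonnegative linear functional with positive total weight can not be strictly
improved by convex combinations. -/
theorem mem_supportedNondominated {Y : Set Outcome} {y w : Outcome} (hy : y ∈ nondominated Y)
    (h0 : 0 ≤ w 0) (h1 : 0 ≤ w 1) (hpos : 0 < w 0 + w 1)
    (hmin : ∀ y' ∈ Y, w ⬝ᵥ y ≤ w ⬝ᵥ y') : y ∈ supportedNondominated Y := by
  refine ⟨hy, ?_⟩
  rintro ⟨z, hz, hlt⟩
  have hconv : Convex ℝ {v : Outcome | w ⬝ᵥ y ≤ w ⬝ᵥ v} :=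
    convex_halfSpace_ge ⟨fun a b => dotProduct_add w a b, fun c a => dotProduct_smul c w a⟩ _
  have hzy : w ⬝ᵥ y ≤ w ⬝ᵥ z :=
    convexHull_min (fun v hv => hmin v hv.1.1) hconv hz
  rw [dotProduct_outcome, dotProduct_outcome] at hzy
  have a0 := hlt 0
  have a1 := hlt 1
  rcases h0.eq_or_lt with h | h
  · rw [← h] at hpos hzy
    nlinarith
  · nlinarith [mul_nonneg h1 (sub_nonneg.2 a1.le)]

theorem mem_nondominated_of_weights {Y : Set Outcome} {y w : Outcome} (hy : y ∈ Y)
    (h0 : 0 < w 0) (h1 : 0 < w 1) (hmin : ∀ y' ∈ Y, w ⬝ᵥ y ≤ w ⬝ᵥ y') :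
    y ∈ nondominated Y := by
  refine ⟨hy, ?_⟩
  rintro ⟨z, hz, hle, hne⟩
  have hzy := hmin z hz
  rw [dotProduct_outcome, dotProduct_outcome] at hzy
  obtain ⟨l0, l1⟩ := outcome_le_iff.1 hle
  refine hne (outcome_ext ?_ ?_)
  · nlinarith [mul_nonneg h1.le (sub_nonneg.2 l1)]
  · nlinarith [mul_nonneg h0.le (sub_nonneg.2 l0)]

/-- If a finite set of nondominated points dominates all nondominated points by its convex
combinations, then those of its points not dominated by convex combinations of the others are
extreme supported. -/
theorem mem_extremeSupportedNondominated {Y Ys : Set Outcome} (hfin : Ys.Finite)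
    (hcomplete : ∀ y ∈ nondominated Y, ∃ w ∈ convexHull ℝ Ys, w ≤ y) {y : Outcome}
    (hy : y ∈ nondominated Y) (hext : ¬ ∃ z ∈ convexHull ℝ (Ys \ {y}), z ≤ y) :
    y ∈ extremeSupportedNondominated Y := by
  refine ⟨hy, ?_⟩
  rintro ⟨z, hz, hzy⟩
  have hdisj : Disjoint (Set.Iic y) (convexHull ℝ (Ys \ {y})) :=
    Set.disjoint_left.2 fun v hv hv' => hext ⟨v, hv', hv⟩
  -- Being bounded above on the whole quadrant below `y`, the separating functional must be
  -- monotone.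
  obtain ⟨l, a, b, hl, hab, hr⟩ := geometric_hahn_banach_closed_compact (convex_Iic y) isClosed_Iic
    (convex_convexHull ℝ _) (hfin.sdiff.isCompact_convexHull (𝕜 := ℝ)) hdisj
  have hmono : ∀ v, 0 ≤ v → 0 ≤ l v := by
    intro v hv
    by_contra! hneg
    obtain ⟨N, hN⟩ := exists_nat_gt ((a - l y) / (-l v))
    have h1 := hl (y - (N : ℝ) • v) (by
      simpa using smul_nonneg (Nat.cast_nonneg N : (0 : ℝ) ≤ N) hv)
    rw [map_sub, map_smul, smul_eq_mul] at h1
    rw [div_lt_iff₀ (by linarith)] at hN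
    linarith
  have hmono' : ∀ v w, v ≤ w → l v ≤ l w := fun v w hvw => by
    have := hmono (w - v) (sub_nonneg.2 hvw)
    rw [map_sub] at this
    linarith
  have hconv : Convex ℝ {v : Outcome | l y < l v} := convex_halfSpace_gt l.isLinear _
  -- A point of the hull is a combination of `y` with a point of the hull of the others. Any
  -- positive share of the latter raises `l` strictly above its value at `y`.
  have hlt : ∀ v ∈ convexHull ℝ Ys, v = y ∨ l y < l v := by
    intro v hv
    have hv' : v ∈ convexHull ℝ (insert y (Ys \ {y})) :=
      convexHull_mono (by intro u hu; by_cases h : u = y <;> simp [h, hu]) hv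
    rcases (Ys \ {y}).eq_empty_or_nonempty with he | hne
    · rw [he] at hv'
      left; simpa using hv'
    · rw [convexHull_insert hne] at hv'
      rw [convexJoin_singleton_left] at hv'
      obtain ⟨u, hu, p, q, hp, hq, hpq, rfl⟩ := Set.mem_iUnion₂.1 hv'
      have hyu : l y < l u := (hl y Set.self_mem_Iic).trans (hab.trans (hr u hu))
      rcases hq.eq_or_lt with h | h
      · left
        rw [← h, add_zero] at hpq
        simp [← h, hpq]
      · right
        rw [map_add, map_smul, map_smul, smul_eq_mul, smul_eq_mul]
        calc l y = p * l y + q * l y := by rw [← add_mul, hpq, one_mul]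
          _ < _ := by gcongr
  have hN : nondominated Y \ {y} ⊆ {v : Outcome | l y < l v} := by
    rintro v ⟨hv, hvy⟩
    -- The case `w = y` would put `y` below the nondominated point `v`, forcing `v = y`.
    obtain ⟨w, hw, hwv⟩ := hcomplete v hv
    rcases hlt w hw with rfl | hlw
    · exact absurd (mem_nondominated_eq hv hy.1 hwv).symm hvy
    · exact hlw.trans_le (hmono' _ _ hwv)
  have hz' : l y < l z := convexHull_min hN hconv hz
  exact absurd (hmono' _ _ hzy) (not_le.2 hz')

/-! ### Invariants of the main loop -/

/-- `y` is nondominated and minimizes some nonzero nonnegative weighted sum over `Y`. -/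
structure IsWeightOptimal (Y : Set Outcome) (y : Outcome) : Prop where
  mem_nondominated : y ∈ nondominated Y
  exists_weight : ∃ w : Outcome, 0 ≤ w 0 ∧ 0 ≤ w 1 ∧ 0 < w 0 + w 1 ∧
    ∀ y' ∈ Y, w ⬝ᵥ y ≤ w ⬝ᵥ y'

theorem IsWeightOptimal.mem_supportedNondominated {Y : Set Outcome} {y : Outcome}
    (h : IsWeightOptimal Y y) : y ∈ supportedNondominated Y := by
  obtain ⟨w, h0, h1, hpos, hmin⟩ := h.exists_weight
  exact _root_.mem_supportedNondominated h.1 h0 h1 hpos hmin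

/-- Points that improve on both points of a pair with respect to its weights lie strictly between
them. -/
theorem IsWeightOptimal.bracket {Y : Set Outcome} {yl yr z : Outcome} (hl : IsWeightOptimal Y yl)
    (hr : IsWeightOptimal Y yr) (h0 : yl 0 < yr 0) (h1 : yr 1 < yl 1) (hz : z ∈ Y)
    (hlt : BROData.weights yl yr ⬝ᵥ z < BROData.weights yl yr ⬝ᵥ yl) :
    (yl 0 < z 0 ∧ z 0 < yr 0) ∧ yr 1 < z 1 ∧ z 1 < yl 1 := by
  simp only [weights_dotProduct] at hlt
  have ha : 0 < yr 0 - yl 0 := sub_pos.2 h0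
  have hb : 0 < yl 1 - yr 1 := sub_pos.2 h1
  have hA : yl 0 < z 0 := by
    by_contra! hc
    have hq : yl 1 < z 1 := by
      by_contra! hd
      rw [mem_nondominated_eq hl.1 hz (outcome_le_iff.2 ⟨hc, hd⟩)] at hlt
      exact lt_irrefl _ hlt
    obtain ⟨w, w0, w1, wpos, hmin⟩ := hl.exists_weight
    have e1 := hmin z hz
    have e2 := hmin yr hr.1.1
    simp only [dotProduct_outcome] at e1 e2
    have hp : z 0 < yl 0 := by
      refine lt_of_le_of_ne hc fun h => ?_
      rw [h] at hlt
      nlinarith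
    -- If `z` were not to the right of `yl`, the segment from `z` to `yr` would pass strictly below
    -- `yl`. Combining `e1` and `e2` with the coefficients of that segment cancels `w 0`. The
    -- remaining factor of `w 1` is positive by `hlt`, so `w 1 = 0`, and then `z` beats `yl` in the
    -- first objective.
    have e3 : w 1 * ((yl 1 - yr 1) * (yl 0 - z 0) - (yr 0 - yl 0) * (z 1 - yl 1)) ≤ 0 := by
      nlinarith [mul_nonneg ha.le (sub_nonneg.2 e1), mul_nonneg (sub_pos.2 hp).le (sub_nonneg.2 e2)]
    have e4 : w 1 = 0 := le_antisymm (nonpos_of_mul_nonpos_left e3 (by linarith)) w1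
    rw [e4] at e1 wpos
    nlinarith
  have hB : yr 1 < z 1 := by
    by_contra! hc
    have hq : yr 0 < z 0 := by
      by_contra! hd
      rw [mem_nondominated_eq hr.1 hz (outcome_le_iff.2 ⟨hd, hc⟩)] at hlt
      linarith
    obtain ⟨w, w0, w1, wpos, hmin⟩ := hr.exists_weight
    have e1 := hmin z hz
    have e2 := hmin yl hl.1.1
    simp only [dotProduct_outcome] at e1 e2
    have hp : z 1 < yr 1 := by
      refine lt_of_le_of_ne hc fun h => ?_
      rw [h] at hlt
      nlinarith
    -- The mirror image: the segment from `yl` to `z` would pass to the left of `yr`, and now `w 1`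
    -- cancels.
    have e3 : w 0 * ((yr 0 - yl 0) * (yr 1 - z 1) - (yl 1 - yr 1) * (z 0 - yr 0)) ≤ 0 := by
      nlinarith [mul_nonneg hb.le (sub_nonneg.2 e1), mul_nonneg (sub_pos.2 hp).le (sub_nonneg.2 e2)]
    have e4 : w 0 = 0 := le_antisymm (nonpos_of_mul_nonpos_left e3 (by linarith)) w0
    rw [e4] at e1 wpos
    nlinarith
  refine ⟨⟨hA, ?_⟩, hB, ?_⟩ <;> by_contra! hc <;> nlinarith

/-- The pending pair `(p.1, p.2)` consists of neighbours among the found points `Ys`. -/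
structure IsPendingPair (Ys : Set Outcome) (p : Outcome × Outcome) : Prop where
  fst_mem : p.1 ∈ Ys
  snd_mem : p.2 ∈ Ys
  lt_zero : p.1 0 < p.2 0
  lt_one : p.2 1 < p.1 1
  not_between : ∀ y ∈ Ys, ¬ (p.1 0 < y 0 ∧ y 0 < p.2 0)

/-- The invariant of the main loop for `min_{x ∈ X} g x`. -/
structure LoopInv {E : Type*} (X : Set E) (g : E → Outcome) (Xs : Set E) (Ys : Set Outcome)
    (L : Multiset (Outcome × Outcome)) : Prop where
  finite : Xs.Finite
  subset : Xs ⊆ X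
  image : g '' Xs = Ys
  optimal : ∀ y ∈ Ys, IsWeightOptimal (g '' X) y
  pending : ∀ p ∈ L, IsPendingPair Ys p
  nodup : (L.map fun p => p.1 0).Nodup
  complete : ∀ y ∈ nondominated (g '' X),
    (∃ w ∈ convexHull ℝ Ys, w ≤ y) ∨ ∃ p ∈ L, p.1 0 < y 0 ∧ y 0 < p.2 0

/-- `x` minimizes the objective `i` over `X`, and the objective `j` among the minimizers of `i`. -/
def IsLexMin {E : Type*} (X : Set E) (g : E → Outcome) (i j : Fin 2) (x : E) : Prop :=
  x ∈ X ∧ ∀ x' ∈ X, g x i ≤ g x' i ∧ (g x' i ≤ g x i → g x j ≤ g x' j)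

/-! ### Lexicographic minimizers and the start of the main loop -/

section Lex

variable {E : Type*} {X : Set E} {g : E → Outcome} {x xL xR : E}

theorem IsLexMin.isWeightOptimal_zero (h : IsLexMin X g 0 1 x) :
    IsWeightOptimal (g '' X) (g x) := by
  refine ⟨⟨⟨x, h.1, rfl⟩, ?_⟩, ![1, 0], by simp, by simp, by simp, ?_⟩
  · rintro ⟨_, ⟨x', hx', rfl⟩, hle, hne⟩
    obtain ⟨l0, l1⟩ := outcome_le_iff.1 hle
    exact hne (outcome_ext (le_antisymm l0 (h.2 x' hx').1) (le_antisymm l1 ((h.2 x' hx').2 l0)))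
  · rintro _ ⟨x', hx', rfl⟩
    simp [-Matrix.cons_dotProduct, (h.2 x' hx').1]

theorem IsLexMin.isWeightOptimal_one (h : IsLexMin X g 1 0 x) :
    IsWeightOptimal (g '' X) (g x) := by
  refine ⟨⟨⟨x, h.1, rfl⟩, ?_⟩, ![0, 1], by simp, by simp, by simp, ?_⟩
  · rintro ⟨_, ⟨x', hx', rfl⟩, hle, hne⟩
    obtain ⟨l0, l1⟩ := outcome_le_iff.1 hle
    exact hne (outcome_ext (le_antisymm l0 ((h.2 x' hx').2 l1)) (le_antisymm l1 (h.2 x' hx').1))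
  · rintro _ ⟨x', hx', rfl⟩
    simp [-Matrix.cons_dotProduct, (h.2 x' hx').1]

theorem LoopInv.of_eq (hL : IsLexMin X g 0 1 xL) (hR : IsLexMin X g 1 0 xR)
    (heq : g xL = g xR) : LoopInv X g {xL} {g xL} 0 where
  finite := Set.finite_singleton _
  subset := by simpa using hL.1
  image := by simp
  optimal := by rintro _ rfl; exact hL.isWeightOptimal_zero
  pending := by simp
  nodup := by simp
  complete := by
    rintro _ ⟨⟨x, hx, rfl⟩, -⟩
    exact .inl ⟨g xL, by simp, outcome_le_iff.2 ⟨(hL.2 x hx).1, heq ▸ (hR.2 x hx).1⟩⟩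

/-- A nondominated point level with `g xL` in the first objective lies above `g xL`, and one not to
the left of `g xR` lies above `g xR`. All others fall into the single initial gap. -/
theorem LoopInv.of_ne (hL : IsLexMin X g 0 1 xL) (hR : IsLexMin X g 1 0 xR)
    (hne : g xL ≠ g xR) : LoopInv X g {xL, xR} {g xL, g xR} {(g xL, g xR)} := by
  have h0 : g xL 0 < g xR 0 := by
    refine lt_of_le_of_ne (hL.2 xR hR.1).1 fun h => hne (outcome_ext h ?_)
    exact le_antisymm ((hL.2 xR hR.1).2 h.ge) (hR.2 xL hL.1).1
  have h1 : g xR 1 < g xL 1 := by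
    refine lt_of_le_of_ne (hR.2 xL hL.1).1 fun h => hne (outcome_ext ?_ h.symm)
    exact le_antisymm (hL.2 xR hR.1).1 ((hR.2 xL hL.1).2 h.ge)
  refine ⟨by simp, by simp [Set.insert_subset_iff, hL.1, hR.1], by simp [Set.image_pair], ?_, ?_,
    by simp, ?_⟩
  · rintro _ (rfl | rfl)
    exacts [hL.isWeightOptimal_zero, hR.isWeightOptimal_one]
  · intro p hp
    obtain rfl := Multiset.mem_singleton.1 hp
    refine ⟨by simp, by simp, h0, h1, ?_⟩
    rintro _ (rfl | rfl) <;> simp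
  · rintro y hy
    obtain ⟨⟨x, hx, rfl⟩, -⟩ := id hy
    rcases (hL.2 x hx).1.eq_or_lt with h | h
    · exact .inl ⟨g xL, subset_convexHull ℝ _ (by simp),
        outcome_le_iff.2 ⟨h.le, (hL.2 x hx).2 h.ge⟩⟩
    · rcases lt_or_ge (g x 0) (g xR 0) with h' | h'
      · exact .inr ⟨_, Multiset.mem_singleton_self _, h, h'⟩
      · exact .inl ⟨g xR, subset_convexHull ℝ _ (by simp),
          outcome_le_iff.2 ⟨h', (hR.2 x hx).1⟩⟩

end Lex

/-! ### Updating the pending pairs, and correctness at the end -/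

section Pairs

variable {E : Type*} {X : Set E} {g : E → Outcome} {Xs : Set E} {Ys : Set Outcome}
  {L : Multiset (Outcome × Outcome)} {yl yr : Outcome} {x : E}

theorem IsPendingPair.weights_pos {p : Outcome × Outcome} (h : IsPendingPair Ys p) :
    0 < BROData.weights p.1 p.2 0 ∧ 0 < BROData.weights p.1 p.2 1 := by
  simpa [BROData.weights] using And.intro h.lt_one h.lt_zero

theorem IsPendingPair.insert_of_not {p : Outcome × Outcome} {y : Outcome}
    (h : IsPendingPair Ys p) (hy : ¬ (p.1 0 < y 0 ∧ y 0 < p.2 0)) :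
    IsPendingPair (insert y Ys) p :=
  { h with
    fst_mem := .inr h.fst_mem
    snd_mem := .inr h.snd_mem
    not_between := by rintro _ (rfl | hz); exacts [hy, h.not_between _ hz] }

theorem LoopInv.bracket (hI : LoopInv X g Xs Ys ((yl, yr) ::ₘ L)) {z : Outcome}
    (hz : z ∈ g '' X) (hlt : BROData.weights yl yr ⬝ᵥ z < BROData.weights yl yr ⬝ᵥ yl) :
    (yl 0 < z 0 ∧ z 0 < yr 0) ∧ yr 1 < z 1 ∧ z 1 < yl 1 := by
  have hp := hI.pending _ (Multiset.mem_cons_self _ _)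
  exact (hI.optimal _ hp.fst_mem).bracket (hI.optimal _ hp.snd_mem) hp.lt_zero hp.lt_one hz hlt

/-- The new point lies strictly inside the gap of the removed pair and splits it in two. A
nondominated point with the same first coordinate cannot lie strictly below it, as positive weights
make the new point nondominated. -/
theorem LoopInv.insert (hI : LoopInv X g Xs Ys ((yl, yr) ::ₘ L)) (hx : x ∈ X)
    (hmin : ∀ x' ∈ X, BROData.weights yl yr ⬝ᵥ g x ≤ BROData.weights yl yr ⬝ᵥ g x')
    (hne : BROData.weights yl yr ⬝ᵥ g x ≠ BROData.weights yl yr ⬝ᵥ yl) :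
    LoopInv X g (insert x Xs) (insert (g x) Ys) ((yl, g x) ::ₘ (g x, yr) ::ₘ L) := by
  have hp := hI.pending _ (Multiset.mem_cons_self _ _)
  obtain ⟨w0, w1⟩ := hp.weights_pos
  obtain ⟨m1, m2, p, q, nb⟩ := id hp
  simp only at w0 w1 m1 m2 p q nb
  have hlt : BROData.weights yl yr ⬝ᵥ g x < BROData.weights yl yr ⬝ᵥ yl := by
    refine lt_of_le_of_ne ?_ hne
    obtain ⟨x', hx', rfl⟩ := (hI.optimal _ m1).1.1
    exact hmin x' hx'
  obtain ⟨⟨a, b⟩, c, d⟩ := hI.bracket ⟨x, hx, rfl⟩ hlt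
  have hnd := hI.nodup
  rw [Multiset.map_cons, Multiset.nodup_cons] at hnd
  have hmin' : ∀ y ∈ g '' X, BROData.weights yl yr ⬝ᵥ g x ≤ BROData.weights yl yr ⬝ᵥ y := by
    rintro _ ⟨x', hx', rfl⟩
    exact hmin x' hx'
  have hxnd : g x ∈ nondominated (g '' X) := mem_nondominated_of_weights ⟨x, hx, rfl⟩ w0 w1 hmin'
  refine ⟨hI.finite.insert x, Set.insert_subset hx hI.subset, by rw [Set.image_insert_eq, hI.image],
    ?_, ?_, ?_, ?_⟩
  · rintro _ (rfl | hy)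
    · exact ⟨hxnd, _, w0.le, w1.le, add_pos w0 w1, hmin'⟩
    · exact hI.optimal _ hy
  · intro r hr
    rcases Multiset.mem_cons.1 hr with rfl | hr
    · refine ⟨.inr m1, .inl rfl, a, d, ?_⟩
      rintro z (rfl | hz) ⟨h1, h2⟩
      · exact lt_irrefl _ h2
      · exact nb z hz ⟨h1, h2.trans b⟩
    rcases Multiset.mem_cons.1 hr with rfl | hr
    · refine ⟨.inl rfl, .inr m2, b, c, ?_⟩
      rintro z (rfl | hz) ⟨h1, h2⟩
      · exact lt_irrefl _ h1
      · exact nb z hz ⟨a.trans h1, h2⟩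
    · have hr' := hI.pending r (Multiset.mem_cons_of_mem hr)
      refine hr'.insert_of_not ?_
      -- Two gaps free of found points that both contain `g x 0` must have the same left end, which
      -- `nodup` rules out.
      rintro ⟨e1, e2⟩
      have n1 := nb _ hr'.fst_mem
      have n2 := hr'.not_between _ m1
      push Not at n1 n2
      have n3 : r.1 0 ≤ yl 0 := le_of_not_gt fun h => absurd (n1 h) (not_le.2 (e1.trans b))
      have n4 : yl 0 ≤ r.1 0 := le_of_not_gt fun h => absurd (n2 h) (not_le.2 (a.trans e2))
      exact hnd.1 (Multiset.mem_map.2 ⟨r, hr, le_antisymm n3 n4⟩)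
  · simp only [Multiset.map_cons, Multiset.nodup_cons, Multiset.mem_cons]
    refine ⟨?_, ?_, hnd.2⟩
    · rintro (h | h)
      exacts [a.ne h, hnd.1 h]
    · intro h
      obtain ⟨r, hr, he⟩ := Multiset.mem_map.1 h
      have hr' := hI.pending r (Multiset.mem_cons_of_mem hr)
      exact nb _ hr'.fst_mem (by rw [he]; exact ⟨a, b⟩)
  · intro y hy
    rcases hI.complete y hy with ⟨w, hw, hwy⟩ | ⟨r, hr, hry⟩
    · exact .inl ⟨w, convexHull_mono (Set.subset_insert _ _) hw, hwy⟩
    rcases Multiset.mem_cons.1 hr with rfl | hr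
    · rcases lt_trichotomy (y 0) (g x 0) with h | h | h
      · exact .inr ⟨(yl, g x), by simp, hry.1, h⟩
      · refine .inl ⟨g x, subset_convexHull ℝ _ (.inl rfl), ?_⟩
        rcases le_total (g x 1) (y 1) with h' | h'
        · exact outcome_le_iff.2 ⟨h.ge, h'⟩
        · exact (mem_nondominated_eq hxnd hy.1 (outcome_le_iff.2 ⟨h.le, h'⟩)).ge
      · exact .inr ⟨(g x, yr), by simp, h, hry.2⟩
    · exact .inr ⟨r, by simp [hr], hry⟩

/-- Both ends of the pair have the same weighted value. If it is optimal, every point in the gap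
lies above the segment joining them, namely above the point of the segment with the same first
coordinate. -/
theorem LoopInv.remove (hI : LoopInv X g Xs Ys ((yl, yr) ::ₘ L))
    (hmin : ∀ x' ∈ X, BROData.weights yl yr ⬝ᵥ yl ≤ BROData.weights yl yr ⬝ᵥ g x') :
    LoopInv X g Xs Ys L := by
  have hnd := hI.nodup
  rw [Multiset.map_cons, Multiset.nodup_cons] at hnd
  refine { hI with
    pending := fun p hp => hI.pending p (Multiset.mem_cons_of_mem hp)
    nodup := hnd.2
    complete := fun y hy => ?_ }
  rcases hI.complete y hy with h | ⟨r, hr, hry⟩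
  · exact .inl h
  rcases Multiset.mem_cons.1 hr with rfl | hr
  · left
    have hp := hI.pending _ (Multiset.mem_cons_self _ _)
    obtain ⟨m1, m2, p, q, -⟩ := id hp
    simp only at hry m1 m2 p q
    obtain ⟨x, hx, rfl⟩ := hy.1
    have h := hmin x hx
    simp only [weights_dotProduct] at h
    have ha : 0 < yr 0 - yl 0 := sub_pos.2 p
    set t := (g x 0 - yl 0) / (yr 0 - yl 0) with ht
    have hta : t * (yr 0 - yl 0) = g x 0 - yl 0 := div_mul_cancel₀ _ ha.ne'
    have ht0 : 0 ≤ t := div_nonneg (by linarith) ha.le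
    have ht1 : t ≤ 1 := (div_le_one ha).2 (by linarith)
    refine ⟨(1 - t) • yl + t • yr, (convex_convexHull ℝ Ys) (subset_convexHull ℝ _ m1)
      (subset_convexHull ℝ _ m2) (by linarith) ht0 (by ring), outcome_le_iff.2 ⟨?_, ?_⟩⟩
    · simp only [Pi.add_apply, Pi.smul_apply, smul_eq_mul]
      linarith
    · simp only [Pi.add_apply, Pi.smul_apply, smul_eq_mul]
      refine le_of_mul_le_mul_left ?_ ha
      have h2 : (yr 0 - yl 0) * ((1 - t) * yl 1 + t * yr 1) =
          (yr 0 - yl 0) * yl 1 + t * (yr 0 - yl 0) * (yr 1 - yl 1) := by ring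
      rw [h2, hta]
      linarith
  · exact .inr ⟨r, hr, hry⟩

/-- A newly found solution lies in a cell that contains no solution found before. -/
theorem LoopInv.cell_notMem {n : ℕ} {X Xs : Set (Fin n → ℝ)} {g : (Fin n → ℝ) → Outcome}
    {x : Fin n → ℝ} {κ : Type*} {cell : (Fin n → ℝ) → κ}
    (hI : LoopInv X g Xs Ys ((yl, yr) ::ₘ L))
    (hext : ∀ x ∈ X, ∀ x' ∈ X, cell x = cell x' → ∀ᶠ s : ℝ in 𝓝[>] 0,
      x + s • (x - x') ∈ X ∧ g (x + s • (x - x')) = g x + s • (g x - g x'))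
    (hx : x ∈ X)
    (hmin : ∀ x' ∈ X, BROData.weights yl yr ⬝ᵥ g x ≤ BROData.weights yl yr ⬝ᵥ g x')
    (hne : BROData.weights yl yr ⬝ᵥ g x ≠ BROData.weights yl yr ⬝ᵥ yl) :
    cell x ∉ cell '' Xs := by
  rintro ⟨x', hx', hc⟩
  have hp := hI.pending _ (Multiset.mem_cons_self _ _)
  obtain ⟨s, ⟨hsX, hsg⟩, hs⟩ :=
    ((hext x hx x' (hI.subset hx') hc.symm).and self_mem_nhdsWithin).exists
  have hs : 0 < s := hs
  have h1 := hmin _ hsX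
  rw [hsg, dotProduct_add, dotProduct_smul, dotProduct_sub, smul_eq_mul] at h1
  -- Optimality of `x` against the point beyond it shows that `x'` is no worse than `x`. So `g x'`
  -- improves on `yl` and lies in the gap, although it was already found.
  have h2 := nonneg_of_mul_nonneg_right (le_add_iff_nonneg_right _ |>.1 h1) hs
  have hlt : BROData.weights yl yr ⬝ᵥ g x < BROData.weights yl yr ⬝ᵥ yl := by
    refine lt_of_le_of_ne ?_ hne
    obtain ⟨u, hu, he⟩ := (hI.optimal _ hp.fst_mem).1.1
    simp only at he
    exact he ▸ hmin u hu
  exact hp.not_between (g x') (hI.image ▸ ⟨x', hx', rfl⟩)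
    (hI.bracket ⟨x', hI.subset hx', rfl⟩ (by linarith)).1

/-- When no pair is pending, the found solutions are as required. -/
theorem LoopInv.correct (hI : LoopInv X g Xs Ys 0) :
    Xs.Finite ∧ g '' Xs = Ys ∧ (∀ x ∈ Xs, IsSupportedEfficient X g x) ∧
      extremeSupportedNondominated (g '' X) ⊆ Ys ∧
      (∃ R ⊆ Xs, IsRepresentativeESE X g R) ∧ IsRepresentativeESE X g (extremePart g Xs) := by
  have hcomplete : ∀ y ∈ nondominated (g '' X), ∃ w ∈ convexHull ℝ Ys, w ≤ y := fun y hy =>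
    (hI.complete y hy).resolve_right (by simp)
  have hmono : ∀ y, convexHull ℝ (Ys \ {y}) ⊆ convexHull ℝ (nondominated (g '' X) \ {y}) :=
    fun y => convexHull_mono (Set.sdiff_subset_sdiff_left fun z hz => (hI.optimal z hz).1)
  have hesn : extremeSupportedNondominated (g '' X) ⊆ Ys := by
    intro y hy
    by_contra hno
    obtain ⟨w, hw, hwy⟩ := hcomplete y hy.1
    -- As `y` was not found, deleting it from `Ys` changes nothing.
    refine hy.2 ⟨w, hmono y ?_, hwy⟩
    rwa [Set.sdiff_singleton_eq_self hno]
  have hrep : IsRepresentativeESE X g (extremePart g Xs) := by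
    refine ⟨fun x hx => hI.subset hx.1, Set.Subset.antisymm ?_ fun y hy => ?_⟩
    · rintro _ ⟨x, ⟨hx, hno⟩, rfl⟩
      rw [hI.image] at hno
      exact mem_extremeSupportedNondominated (hI.image ▸ hI.finite.image g) hcomplete
        (hI.optimal _ (hI.image ▸ ⟨x, hx, rfl⟩)).1 hno
    · have hy' := hesn hy
      rw [← hI.image] at hy'
      obtain ⟨x, hx, rfl⟩ := hy'
      refine ⟨x, ⟨hx, ?_⟩, rfl⟩
      rintro ⟨z, hz, hle⟩
      rw [hI.image] at hz
      exact hy.2 ⟨z, hmono _ hz, hle⟩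
  exact ⟨hI.finite, hI.image, fun x hx => ⟨hI.subset hx,
    (hI.optimal _ (hI.image ▸ ⟨x, hx, rfl⟩)).mem_supportedNondominated⟩, hesn,
    ⟨_, fun x hx => hx.1, hrep⟩, hrep⟩

end Pairs

/-! ### The cells of a biobjective mixed-integer linear robust problem -/

namespace BROData

variable {n m : ℕ} {B : BROData n m}

/-- For a polytope, the sublevel set at the largest value on the generators is convex and contains
them, hence contains their hull. -/
theorem IsBRO.exists_dominating (hB : B.IsBRO) : ∃ T : Finset (Fin m → ℝ), T.Nonempty ∧
    (T : Set (Fin m → ℝ)) ⊆ B.U ∧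
    ∀ i, ∀ x ∈ B.X, ∀ ξ ∈ B.U, ∃ t ∈ T, B.f i x ξ ≤ B.f i x t := by
  rcases hB.uncertainty with hfin | ⟨⟨T, hT⟩, hq⟩
  · exact ⟨hfin.toFinset, by simpa using hB.scenario, by simp,
      fun i x _ ξ hξ => ⟨ξ, by simpa using hξ, le_rfl⟩⟩
  · have hne : T.Nonempty := by simpa [hT] using hB.scenario
    have hsub : (T : Set (Fin m → ℝ)) ⊆ B.U := hT ▸ subset_convexHull ℝ _
    refine ⟨T, hne, hsub, fun i x hx ξ hξ => ?_⟩
    obtain ⟨t, ht, hmax⟩ := T.exists_max_image (B.f i x) hne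
    refine ⟨t, ht, ?_⟩
    have hξ' : ξ ∈ convexHull ℝ (T : Set (Fin m → ℝ)) := hT ▸ hξ
    have hT' : (T : Set (Fin m → ℝ)) ⊆ {u | u ∈ B.U ∧ B.f i x u ≤ B.f i x t} :=
      fun u hu => ⟨hsub hu, hmax u hu⟩
    exact (convexHull_min hT' ((hq i x hx).2 (B.f i x t)) hξ').2

theorem IsBRO.exists_max (hB : B.IsBRO) (i : Fin 2) {x : Fin n → ℝ} (hx : x ∈ B.X) :
    ∃ ξ ∈ B.U, ∀ ξ' ∈ B.U, B.f i x ξ' ≤ B.f i x ξ := by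
  obtain ⟨T, hne, hsub, hdom⟩ := hB.exists_dominating
  obtain ⟨t, ht, hmax⟩ := T.exists_max_image (B.f i x) hne
  refine ⟨t, hsub ht, fun ξ hξ => ?_⟩
  obtain ⟨u, hu, hle⟩ := hdom i x hx ξ hξ
  exact hle.trans (hmax u hu)

theorem IsBRO.isCompact (hB : B.IsBRO) : IsCompact B.X := by
  obtain ⟨hbdd, r, A, b, hP⟩ := hB.polytope
  refine Metric.isCompact_of_isClosed_isBounded ?_ (hbdd.subset fun x hx => hx.1)
  have hZ : IsClosed (Set.range ((↑) : ℤ → ℝ)) := Int.isClosedEmbedding_coe_real.isClosed_range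
  have heq : B.X = {x | A.mulVec x ≤ b} ∩
      ⋂ j : Fin n, ⋂ _ : (j : ℕ) < B.k, (fun x => x j) ⁻¹' Set.range ((↑) : ℤ → ℝ) := by
    ext x
    simp [X, hP, eq_comm]
  rw [heq]
  refine (isClosed_le (by fun_prop) continuous_const).inter ?_
  exact isClosed_iInter fun j => isClosed_iInter fun _ => hZ.preimage (continuous_apply j)

theorem eventually_affine_lt {a d b : ℝ} (h : a < b) : ∀ᶠ s : ℝ in 𝓝[>] 0, a + s * d < b := by
  have hc : ContinuousAt (fun s : ℝ => a + s * d) 0 := by fun_prop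
  exact nhdsWithin_le_nhds (hc.eventually_lt_const (by simpa using h))

/-- Tight rows and integer coordinates agree at `x` and `x'`, so they stay constant along the line,
while slack rows survive a small step. Likewise, the worst-case scenarios in `T` keep equal values
along the line, and the others stay below them for a short while. -/
theorem IsBRO.exists_cell (hB : B.IsBRO) : ∃ (κ : Type) (cell : (Fin n → ℝ) → κ),
    (cell '' B.X).Finite ∧ ∀ x ∈ B.X, ∀ x' ∈ B.X, cell x = cell x' → ∀ᶠ s : ℝ in 𝓝[>] 0,
      x + s • (x - x') ∈ B.X ∧ B.F (x + s • (x - x')) = B.F x + s • (B.F x - B.F x') := by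
  obtain ⟨hbdd, r, A, b, hP⟩ := hB.polytope
  obtain ⟨T, hne, hsub, hdom⟩ := hB.exists_dominating
  set act : Fin 2 → (Fin n → ℝ) → Set (Fin m → ℝ) :=
    fun i x => {t | t ∈ T ∧ ∀ t' ∈ T, B.f i x t' ≤ B.f i x t} with hact
  have hactF : ∀ i, ∀ x ∈ B.X, ∀ t ∈ act i x, B.F x i = B.f i x t := by
    intro i x hx t ht
    refine worst_eq_of_isMax (hsub ht.1) fun ξ hξ => ?_
    obtain ⟨u, hu, hle⟩ := hdom i x hx ξ hξ
    exact hle.trans (ht.2 u hu)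
  refine ⟨Set (Fin r) × (Fin n → ℤ) × (Fin 2 → Set (Fin m → ℝ)), fun x =>
    ({i | A.mulVec x i = b i}, fun j => if (j : ℕ) < B.k then ⌊x j⌋ else 0, fun i => act i x),
    ?_, ?_⟩
  · obtain ⟨M, hM⟩ := hbdd.exists_norm_le
    have hpow : {s : Set (Fin m → ℝ) | s ⊆ T}.Finite := T.finite_toSet.finite_subsets
    -- The integer interval is stretched to contain 0, the value recorded at continuous coordinates.
    refine Set.Finite.subset (Set.finite_univ.prod
      ((Set.Finite.pi' fun _ : Fin n => (Set.finite_Icc (min ⌊-M⌋ 0) (max ⌊M⌋ 0))).prod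
        (Set.Finite.pi' fun _ : Fin 2 => hpow))) ?_
    rintro _ ⟨x, hx, rfl⟩
    refine ⟨Set.mem_univ _, fun j => ?_, fun i t ht => ht.1⟩
    have hj := abs_le.1 ((norm_le_pi_norm x j).trans (hM x hx.1))
    dsimp only
    split_ifs
    · exact ⟨min_le_of_left_le (Int.floor_mono hj.1), le_max_of_le_left (Int.floor_mono hj.2)⟩
    · simp
  · intro x hx x' hx' hcell
    obtain ⟨hrow, hint, hact'⟩ : _ ∧ _ ∧ _ := by simpa only [Prod.mk.injEq] using hcell
    have hmemX : ∀ᶠ s : ℝ in 𝓝[>] 0, x + s • (x - x') ∈ B.X := by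
      have hrows : ∀ᶠ s : ℝ in 𝓝[>] 0, ∀ i, A.mulVec (x + s • (x - x')) i ≤ b i := by
        refine eventually_all.2 fun i => ?_
        have hexp : ∀ s : ℝ, A.mulVec (x + s • (x - x')) i =
            A.mulVec x i + s * (A.mulVec x i - A.mulVec x' i) := fun s => by
          simp [Matrix.mulVec_add, Matrix.mulVec_smul, Matrix.mulVec_sub]
        simp only [hexp]
        have hxP : A.mulVec x ≤ b := by simpa [hP] using hx.1
        rcases (hxP i).eq_or_lt with h | h
        · have h' : A.mulVec x' i = b i := by
            have : i ∈ {i | A.mulVec x i = b i} := h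
            rwa [hrow] at this
          exact .of_forall fun s => by simp [h, h']
        · exact (eventually_affine_lt h).mono fun s hs => hs.le
      refine hrows.mono fun s hs => ⟨by rw [hP]; exact hs, fun j hj => ?_⟩
      obtain ⟨z, hz⟩ := hx.2 j hj
      obtain ⟨z', hz'⟩ := hx'.2 j hj
      have h := congrFun hint j
      simp only [hj, if_true, hz, hz', Int.floor_intCast] at h
      exact ⟨z, by simp [hz, hz', h]⟩
    have hobj : ∀ᶠ s : ℝ in 𝓝[>] 0, x + s • (x - x') ∈ B.X →
        ∀ i, B.F (x + s • (x - x')) i = B.F x i + s * (B.F x i - B.F x' i) := by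
      have hlin : ∀ i, ∀ t ∈ T, ∀ s : ℝ, x + s • (x - x') ∈ B.X →
          B.f i (x + s • (x - x')) t = B.f i x t + s * (B.f i x t - B.f i x' t) := by
        intro i t ht s hs
        obtain ⟨c, hc⟩ := hB.linear i t (hsub ht)
        rw [hc _ hs, hc x hx, hc x' hx', dotProduct_add, dotProduct_smul, dotProduct_sub,
          smul_eq_mul]
      have hmain : ∀ i, ∀ᶠ s : ℝ in 𝓝[>] 0, x + s • (x - x') ∈ B.X →
          B.F (x + s • (x - x')) i = B.F x i + s * (B.F x i - B.F x' i) := by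
        intro i
        obtain ⟨t, ht⟩ : (act i x).Nonempty := T.exists_max_image (B.f i x) hne
        have hai : act i x = act i x' := congrFun hact' i
        have ht' : t ∈ act i x' := hai ▸ ht
        have hev : ∀ u ∈ T, ∀ᶠ s : ℝ in 𝓝[>] 0,
            B.f i x u + s * (B.f i x u - B.f i x' u) ≤
              B.f i x t + s * (B.f i x t - B.f i x' t) := by
          intro u hu
          by_cases hua : u ∈ act i x
          · have hua' : u ∈ act i x' := hai ▸ hua
            have e1 := le_antisymm (ht.2 u hu) (hua.2 t ht.1)
            have e2 := le_antisymm (ht'.2 u hu) (hua'.2 t ht.1)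
            exact .of_forall fun s => by rw [e1, e2]
          · have hlt : B.f i x u < B.f i x t := by
              by_contra! hc
              exact hua ⟨hu, fun t' ht' => (ht.2 t' ht').trans hc⟩
            filter_upwards [eventually_affine_lt
              (d := B.f i x u - B.f i x' u - (B.f i x t - B.f i x' t)) hlt] with s hs
            linarith
        filter_upwards [(eventually_all_finset T).2 hev] with s hs hsX
        rw [hactF i x hx t ht, hactF i x' hx' t ht', hactF i _ hsX t ⟨ht.1, fun u hu => ?_⟩,
          hlin i t ht.1 s hsX]
        rw [hlin i t ht.1 s hsX, hlin i u hu s hsX]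
        exact hs u hu
      filter_upwards [eventually_all.2 hmain] with s hs hsX i using hs i hsX
    filter_upwards [hmemX, hobj] with s hs hs'
    exact ⟨hs, funext fun i => by simpa using hs' hs i⟩

end BROData

/-! ### The three kinds of subproblem as cellular problems -/

section Problems

variable {n m : ℕ} {B : BROData n m} {κ : Type*} {cell : (Fin n → ℝ) → κ}

/-- The cells of a biobjective problem: there are finitely many, and from each feasible point one
can go a bit further in the direction away from any other feasible point of its cell, with the
worst-case objective vector changing linearly. -/
structure BROData.IsCellular (B : BROData n m) (cell : (Fin n → ℝ) → κ) : Prop where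
  finite : (cell '' B.X).Finite
  extend : ∀ x ∈ B.X, ∀ x' ∈ B.X, cell x = cell x' → ∀ᶠ s : ℝ in 𝓝[>] 0,
    x + s • (x - x') ∈ B.X ∧ B.F (x + s • (x - x')) = B.F x + s • (B.F x - B.F x')

theorem BROData.IsBRO.isCellularProblem (hB : B.IsBRO) (hcell : B.IsCellular cell) (i : Fin 2) :
    IsCellularProblem B.X (B.f i) B.U cell where
  compact := hB.isCompact
  linear := hB.linear i
  exists_max x hx := hB.exists_max i hx
  finite := hcell.finite
  extend x hx x' hx' hc := (hcell.extend x hx x' hx' hc).mono fun s hs =>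
    ⟨hs.1, by simpa [BROData.F] using congrFun hs.2 i⟩

/-- The bound on the supremum is a family of linear inequalities, one per scenario, so it cuts out a
closed set. -/
theorem BROData.IsBRO.isCompact_restricted (hB : B.IsBRO) (i : Fin 2) (ε : ℝ) :
    IsCompact (B.restricted i ε) := by
  choose! c hc using hB.linear
  have heq : B.restricted i ε = B.X ∩ ⋂ ξ ∈ B.U, {x | c i ξ ⬝ᵥ x ≤ ε} := by
    ext x
    simp only [BROData.restricted, Set.mem_ofPred_eq, Set.mem_inter_iff, Set.mem_iInter]
    refine and_congr_right fun hx => (worst_le_iff (hB.exists_max i hx)).trans ?_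
    exact forall₂_congr fun ξ hξ => by rw [hc i ξ hξ x hx]
  rw [heq]
  refine hB.isCompact.inter_right (isClosed_biInter fun ξ _ => ?_)
  exact isClosed_le (by unfold dotProduct; fun_prop) continuous_const

/-- The cells of a lexicographic subproblem. -/
def BROData.restrictedCell (B : BROData n m) (cell : (Fin n → ℝ) → κ) (i : Fin 2) (ε : ℝ)
    (x : Fin n → ℝ) : κ × Prop :=
  (cell x, B.F x i = ε)

/-- The constraint `F i ≤ ε` acts like one more row: the cell records whether it is tight. -/
theorem BROData.IsBRO.isCellularProblem_restricted (hB : B.IsBRO) (hcell : B.IsCellular cell)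
    (i j : Fin 2) (ε : ℝ) : IsCellularProblem (B.restricted i ε) (B.f j) B.U
      (B.restrictedCell cell i ε) where
  compact := hB.isCompact_restricted i ε
  linear ξ hξ := (hB.linear j ξ hξ).imp fun c hc x hx => hc x hx.1
  exists_max x hx := hB.exists_max j hx.1
  finite := (hcell.finite.prod (Set.toFinite (Set.univ : Set Prop))).subset (by
    rintro _ ⟨x, hx, rfl⟩
    exact ⟨⟨x, hx.1, rfl⟩, Set.mem_univ _⟩)
  extend x hx x' hx' hc := by
    obtain ⟨hc, hε⟩ := Prod.mk.inj hc
    have hle : ∀ᶠ s : ℝ in 𝓝[>] 0, B.F x i + s * (B.F x i - B.F x' i) ≤ ε := by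
      rcases hx.2.eq_or_lt with h | h
      · have h' : B.F x' i = ε := hε.mp h
        exact .of_forall fun s => by simp [h, h']
      · exact (BROData.eventually_affine_lt h).mono fun s hs => hs.le
    filter_upwards [hcell.extend x hx.1 x' hx'.1 hc, hle] with s hs hs'
    refine ⟨⟨hs.1, ?_⟩, by simpa [BROData.F] using congrFun hs.2 j⟩
    rw [hs.2]
    simpa using hs'

/-- With nonnegative weights and independent scenarios for the two objectives, the maximum over the
product separates. This is why the product set yields the weighted sum of the two worst cases. -/
theorem BROData.IsBRO.exists_max_scalarized (hB : B.IsBRO) {w : Outcome} (h0 : 0 ≤ w 0)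
    (h1 : 0 ≤ w 1) {x : Fin n → ℝ} (hx : x ∈ B.X) :
    (∃ ξ ∈ B.U ×ˢ B.U, ∀ ξ' ∈ B.U ×ˢ B.U, B.scalarized w x ξ' ≤ B.scalarized w x ξ) ∧
      worst (B.scalarized w) (B.U ×ˢ B.U) x = w ⬝ᵥ B.F x := by
  obtain ⟨a, ha, hma⟩ := hB.exists_max 0 hx
  obtain ⟨b, hb, hmb⟩ := hB.exists_max 1 hx
  have hmax : ∀ ξ' ∈ B.U ×ˢ B.U, B.scalarized w x ξ' ≤ B.scalarized w x (a, b) := fun ξ' hξ' =>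
    add_le_add (mul_le_mul_of_nonneg_left (hma _ hξ'.1) h0)
      (mul_le_mul_of_nonneg_left (hmb _ hξ'.2) h1)
  have hab : (a, b) ∈ B.U ×ˢ B.U := ⟨ha, hb⟩
  refine ⟨⟨(a, b), hab, hmax⟩, ?_⟩
  rw [worst_eq_of_isMax hab hmax, dotProduct_outcome, BROData.F, BROData.F,
    worst_eq_of_isMax ha hma, worst_eq_of_isMax hb hmb, BROData.scalarized]

theorem BROData.IsBRO.isCellularProblem_scalarized (hB : B.IsBRO) (hcell : B.IsCellular cell)
    {w : Outcome} (h0 : 0 ≤ w 0) (h1 : 0 ≤ w 1) :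
    IsCellularProblem B.X (B.scalarized w) (B.U ×ˢ B.U) cell where
  compact := hB.isCompact
  linear ξ hξ := by
    obtain ⟨c, hc⟩ := hB.linear 0 ξ.1 hξ.1
    obtain ⟨d, hd⟩ := hB.linear 1 ξ.2 hξ.2
    refine ⟨w 0 • c + w 1 • d, fun x hx => ?_⟩
    rw [BROData.scalarized, hc x hx, hd x hx, add_dotProduct, smul_dotProduct, smul_dotProduct,
      smul_eq_mul, smul_eq_mul]
  exists_max x hx := (hB.exists_max_scalarized h0 h1 hx).1
  finite := hcell.finite
  extend x hx x' hx' hc := (hcell.extend x hx x' hx' hc).mono fun s hs => by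
    refine ⟨hs.1, ?_⟩
    rw [(hB.exists_max_scalarized h0 h1 hs.1).2, (hB.exists_max_scalarized h0 h1 hx).2,
      (hB.exists_max_scalarized h0 h1 hx').2, hs.2, dotProduct_add, dotProduct_smul,
      dotProduct_sub, smul_eq_mul]

end Problems

/-! ### Invariant and rank of the states of the algorithm -/

namespace BROData

variable {n m : ℕ} {κ : Type*}

/-- The invariant of the states that can be reached by the algorithm. -/
def StateInv (B : BROData n m) : MOAState n m → Prop
  | .minFirst V => IsScenarioSet B.U V
  | .lexFirst ε V => IsScenarioSet B.U V ∧ IsLeast ((fun x => B.F x 0) '' B.X) ε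
  | .minSecond xL V => IsScenarioSet B.U V ∧ IsLexMin B.X B.F 0 1 xL
  | .lexSecond xL ε V => IsScenarioSet B.U V ∧ IsLexMin B.X B.F 0 1 xL ∧
      IsLeast ((fun x => B.F x 1) '' B.X) ε
  | .loop Xs Ys L => LoopInv B.X B.F Xs Ys L
  | .weighted Xs Ys L yl yr V => IsScenarioSet (B.U ×ˢ B.U) V ∧
      LoopInv B.X B.F Xs Ys ((yl, yr) ::ₘ L)
  | .done Xs Ys => LoopInv B.X B.F Xs Ys 0

/-- The number of cells in which no solution has been found. -/
noncomputable def unusedCells (B : BROData n m) (cell : (Fin n → ℝ) → κ)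
    (Xs : Set (Fin n → ℝ)) : ℕ :=
  (cell '' B.X \ cell '' Xs).ncard

/-- A rank that decreases lexicographically in every step of the algorithm: the phase, the number
of unused cells, the work left in the list of pairs, the number of uncovered cells. -/
noncomputable def stateRank (B : BROData n m) (cell : (Fin n → ℝ) → κ) :
    MOAState n m → ℕ ×ₗ ℕ ×ₗ ℕ ×ₗ ℕ
  | .minFirst V => toLex (5, toLex (0, toLex (0, uncovered B.X (B.f 0) B.U cell V)))
  | .lexFirst ε V => toLex (4, toLex (0, toLex (0,
      uncovered (B.restricted 0 ε) (B.f 1) B.U (B.restrictedCell cell 0 ε) V)))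
  | .minSecond _ V => toLex (3, toLex (0, toLex (0, uncovered B.X (B.f 1) B.U cell V)))
  | .lexSecond _ ε V => toLex (2, toLex (0, toLex (0,
      uncovered (B.restricted 1 ε) (B.f 0) B.U (B.restrictedCell cell 1 ε) V)))
  -- Removing a pair lowers `2 * L.card` by two, which leaves an odd value for the running call. A
  -- new solution adds pairs but uses up a cell, which has priority.
  | .loop Xs _ L => toLex (1, toLex (B.unusedCells cell Xs, toLex (2 * L.card, 0)))
  | .weighted Xs _ L yl yr V => toLex (1, toLex (B.unusedCells cell Xs, toLex (2 * L.card + 1,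
      uncovered B.X (B.scalarized (weights yl yr)) (B.U ×ˢ B.U) cell V)))
  | .done _ _ => toLex (0, toLex (0, toLex (0, 0)))

variable {B : BROData n m} {cell : (Fin n → ℝ) → κ} {U₀ : Set (Fin m → ℝ)}
  {W₀ : Set ((Fin m → ℝ) × (Fin m → ℝ))}

theorem isLeast_of_return {S : Type*} {V V' U : Set S} {h : (Fin n → ℝ) → S → ℝ}
    {X : Set (Fin n → ℝ)} {x : Fin n → ℝ} (hp : IsCellularProblem X h U cell)
    (hV : IsScenarioSet U V) (hret : OptPessReturn X h U V x V') :
    IsScenarioSet U V' ∧ IsLeast (worst h U '' X) (worst h U x) := by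
  obtain ⟨hV', hx, hmin⟩ := hp.isMin_of_return hV hret
  exact ⟨hV', ⟨x, hx, rfl⟩, by rintro _ ⟨x', hx', rfl⟩; exact hmin x' hx'⟩

theorem isLexMin_of_return (hB : B.IsBRO) (hcell : B.IsCellular cell) {i j : Fin 2} {ε : ℝ}
    {V V' : Set (Fin m → ℝ)} {x : Fin n → ℝ} (hV : IsScenarioSet B.U V)
    (hε : IsLeast ((fun x => B.F x i) '' B.X) ε)
    (hret : OptPessReturn (B.restricted i ε) (B.f j) B.U V x V') : IsLexMin B.X B.F i j x := by
  obtain ⟨-, hx, hmin⟩ := (hB.isCellularProblem_restricted hcell i j ε).isMin_of_return hV hret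
  refine ⟨hx.1, fun x' hx' => ⟨hx.2.trans (hε.2 ⟨x', hx', rfl⟩), fun hle => ?_⟩⟩
  exact hmin x' ⟨hx', hle.trans hx.2⟩

theorem restricted_nonempty {i : Fin 2} {ε : ℝ} (hε : IsLeast ((fun x => B.F x i) '' B.X) ε) :
    (B.restricted i ε).Nonempty := by
  obtain ⟨x, hx, rfl⟩ := hε.1
  exact ⟨x, hx, le_rfl⟩

theorem isMin_of_scalarized_return (hB : B.IsBRO) (hcell : B.IsCellular cell) {w : Outcome}
    (h0 : 0 ≤ w 0) (h1 : 0 ≤ w 1) {V V' : Set ((Fin m → ℝ) × (Fin m → ℝ))} {x : Fin n → ℝ}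
    (hV : IsScenarioSet (B.U ×ˢ B.U) V)
    (hret : OptPessReturn B.X (B.scalarized w) (B.U ×ˢ B.U) V x V') :
    x ∈ B.X ∧ ∀ x' ∈ B.X, w ⬝ᵥ B.F x ≤ w ⬝ᵥ B.F x' := by
  obtain ⟨-, hx, hmin⟩ := (hB.isCellularProblem_scalarized hcell h0 h1).isMin_of_return hV hret
  refine ⟨hx, fun x' hx' => ?_⟩
  rw [← (hB.exists_max_scalarized h0 h1 hx).2, ← (hB.exists_max_scalarized h0 h1 hx').2]
  exact hmin x' hx'

theorem unusedCells_insert_lt (hcell : B.IsCellular cell) {Xs : Set (Fin n → ℝ)}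
    {x : Fin n → ℝ} (hx : x ∈ B.X) (hno : cell x ∉ cell '' Xs) :
    B.unusedCells cell (insert x Xs) < B.unusedCells cell Xs := by
  refine Set.ncard_lt_ncard ?_ hcell.finite.sdiff
  refine (Set.ssubset_iff_of_subset ?_).2 ⟨cell x, ⟨⟨x, hx, rfl⟩, hno⟩, ?_⟩
  · exact Set.sdiff_subset_sdiff_right (Set.image_mono (Set.subset_insert _ _))
  · exact fun h => h.2 ⟨x, Set.mem_insert _ _, rfl⟩

theorem MOAStep.inv_and_rank_lt (hB : B.IsBRO) (hcell : B.IsCellular cell)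
    (hU₀ : IsScenarioSet B.U U₀) (hW₀ : IsScenarioSet (B.U ×ˢ B.U) W₀) {s s' : MOAState n m}
    (hs : B.StateInv s) (hstep : B.MOAStep U₀ W₀ s s') :
    B.StateInv s' ∧ B.stateRank cell s' < B.stateRank cell s := by
  cases hstep with
  | minFirst_continue h =>
    obtain ⟨h1, h2⟩ := (hB.isCellularProblem hcell 0).uncovered_lt hs h
    exact ⟨h1, by simpa [stateRank, Prod.Lex.toLex_lt_toLex] using h2⟩
  | minFirst_return h =>
    exact ⟨isLeast_of_return (hB.isCellularProblem hcell 0) hs h,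
      by simp [stateRank, Prod.Lex.toLex_lt_toLex]⟩
  | lexFirst_continue h =>
    obtain ⟨h1, h2⟩ := (hB.isCellularProblem_restricted hcell 0 1 _).uncovered_lt hs.1 h
    exact ⟨⟨h1, hs.2⟩, by simpa [stateRank, Prod.Lex.toLex_lt_toLex] using h2⟩
  | lexFirst_return h =>
    exact ⟨⟨hU₀, isLexMin_of_return hB hcell hs.1 hs.2 h⟩,
      by simp [stateRank, Prod.Lex.toLex_lt_toLex]⟩
  | minSecond_continue h =>
    obtain ⟨h1, h2⟩ := (hB.isCellularProblem hcell 1).uncovered_lt hs.1 h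
    exact ⟨⟨h1, hs.2⟩, by simpa [stateRank, Prod.Lex.toLex_lt_toLex] using h2⟩
  | minSecond_return h =>
    obtain ⟨h1, h2⟩ := isLeast_of_return (hB.isCellularProblem hcell 1) hs.1 h
    exact ⟨⟨h1, hs.2, h2⟩, by simp [stateRank, Prod.Lex.toLex_lt_toLex]⟩
  | lexSecond_continue h =>
    obtain ⟨h1, h2⟩ := (hB.isCellularProblem_restricted hcell 1 0 _).uncovered_lt hs.1 h
    exact ⟨⟨h1, hs.2⟩, by simpa [stateRank, Prod.Lex.toLex_lt_toLex] using h2⟩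
  | lexSecond_return_eq h heq =>
    exact ⟨LoopInv.of_eq hs.2.1 (isLexMin_of_return hB hcell hs.1 hs.2.2 h) heq,
      by simp [stateRank, Prod.Lex.toLex_lt_toLex]⟩
  | lexSecond_return_ne h hne =>
    exact ⟨LoopInv.of_ne hs.2.1 (isLexMin_of_return hB hcell hs.1 hs.2.2 h) hne,
      by simp [stateRank, Prod.Lex.toLex_lt_toLex]⟩
  | loop_remove =>
    exact ⟨⟨hW₀, hs⟩, by simp [stateRank, Prod.Lex.toLex_lt_toLex, mul_add]⟩
  | weighted_continue h =>
    obtain ⟨w0, w1⟩ := (hs.2.pending _ (Multiset.mem_cons_self _ _)).weights_pos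
    obtain ⟨h1, h2⟩ := (hB.isCellularProblem_scalarized hcell w0.le w1.le).uncovered_lt hs.1 h
    exact ⟨⟨h1, hs.2⟩, by simpa [stateRank, Prod.Lex.toLex_lt_toLex] using h2⟩
  | weighted_return_new h hne =>
    obtain ⟨w0, w1⟩ := (hs.2.pending _ (Multiset.mem_cons_self _ _)).weights_pos
    obtain ⟨hx, hmin⟩ := isMin_of_scalarized_return hB hcell w0.le w1.le hs.1 h
    have hlt := unusedCells_insert_lt hcell hx (hs.2.cell_notMem hcell.extend hx hmin hne)
    exact ⟨hs.2.insert hx hmin hne, by simp [stateRank, Prod.Lex.toLex_lt_toLex, hlt]⟩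
  | weighted_return_old h heq =>
    obtain ⟨w0, w1⟩ := (hs.2.pending _ (Multiset.mem_cons_self _ _)).weights_pos
    obtain ⟨-, hmin⟩ := isMin_of_scalarized_return hB hcell w0.le w1.le hs.1 h
    exact ⟨hs.2.remove (heq ▸ hmin), by simp [stateRank, Prod.Lex.toLex_lt_toLex]⟩
  | loop_exit => exact ⟨hs, by simp [stateRank, Prod.Lex.toLex_lt_toLex]⟩

theorem StateInv.done_or_exists_step (hB : B.IsBRO) (hcell : B.IsCellular cell)
    {s : MOAState n m} (hs : B.StateInv s) :
    (∃ Xs Ys, s = .done Xs Ys) ∨ ∃ s', B.MOAStep U₀ W₀ s s' := by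
  cases s with
  | minFirst V =>
    rcases (hB.isCellularProblem hcell 0).continue_or_return hB.feasible hs with ⟨V', h⟩ | ⟨x, V', h⟩
    · exact .inr ⟨_, .minFirst_continue h⟩
    · exact .inr ⟨_, .minFirst_return h⟩
  | lexFirst ε V =>
    rcases (hB.isCellularProblem_restricted hcell 0 1 ε).continue_or_return
      (restricted_nonempty hs.2) hs.1 with ⟨V', h⟩ | ⟨x, V', h⟩
    · exact .inr ⟨_, .lexFirst_continue h⟩
    · exact .inr ⟨_, .lexFirst_return h⟩
  | minSecond xL V =>
    rcases (hB.isCellularProblem hcell 1).continue_or_return hB.feasible hs.1 with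
      ⟨V', h⟩ | ⟨x, V', h⟩
    · exact .inr ⟨_, .minSecond_continue h⟩
    · exact .inr ⟨_, .minSecond_return h⟩
  | lexSecond xL ε V =>
    rcases (hB.isCellularProblem_restricted hcell 1 0 ε).continue_or_return
      (restricted_nonempty hs.2.2) hs.1 with ⟨V', h⟩ | ⟨x, V', h⟩
    · exact .inr ⟨_, .lexSecond_continue h⟩
    · by_cases heq : B.F xL = B.F x
      · exact .inr ⟨_, .lexSecond_return_eq h heq⟩
      · exact .inr ⟨_, .lexSecond_return_ne h heq⟩
  | loop Xs Ys L =>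
    induction L using Multiset.induction_on with
    | empty => exact .inr ⟨_, .loop_exit⟩
    | cons p L => exact .inr ⟨_, .loop_remove (yl := p.1) (yr := p.2)⟩
  | weighted Xs Ys L yl yr V =>
    obtain ⟨w0, w1⟩ := (hs.2.pending _ (Multiset.mem_cons_self _ _)).weights_pos
    rcases (hB.isCellularProblem_scalarized hcell w0.le w1.le).continue_or_return hB.feasible
      hs.1 with ⟨V', h⟩ | ⟨x, V', h⟩
    · exact .inr ⟨_, .weighted_continue h⟩
    · by_cases heq : weights yl yr ⬝ᵥ B.F x = weights yl yr ⬝ᵥ yl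
      · exact .inr ⟨_, .weighted_return_old h heq⟩
      · exact .inr ⟨_, .weighted_return_new h heq⟩
  | done Xs Ys => exact .inl ⟨Xs, Ys, rfl⟩

end BROData

theorem mainTheorem2 {n m : ℕ} (B : BROData n m) (hB : B.IsBRO)
    (U₀ : Set (Fin m → ℝ)) (hU₀ : U₀.Finite) (hU₀ne : U₀.Nonempty) (hU₀sub : U₀ ⊆ B.U)
    (W₀ : Set ((Fin m → ℝ) × (Fin m → ℝ))) (hW₀ : W₀.Finite) (hW₀ne : W₀.Nonempty)
    (hW₀sub : W₀ ⊆ B.U ×ˢ B.U) :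
    -- every run stops after finitely many iterations
    (¬ ∃ s : ℕ → MOAState n m, s 0 = .minFirst U₀ ∧ ∀ j, B.MOAStep U₀ W₀ (s j) (s (j + 1))) ∧
    -- no run gets stuck before it returns
    (∀ s, Relation.ReflTransGen (B.MOAStep U₀ W₀) (.minFirst U₀) s →
      (∃ Xs Ys, s = .done Xs Ys) ∨ ∃ s', B.MOAStep U₀ W₀ s s') ∧
    -- whatever is returned is correct
    (∀ Xs Ys, Relation.ReflTransGen (B.MOAStep U₀ W₀) (.minFirst U₀) (.done Xs Ys) →
      Xs.Finite ∧ B.F '' Xs = Ys ∧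
      (∀ x ∈ Xs, IsSupportedEfficient B.X B.F x) ∧
      extremeSupportedNondominated (B.F '' B.X) ⊆ Ys ∧
      (∃ R ⊆ Xs, IsRepresentativeESE B.X B.F R) ∧
      IsRepresentativeESE B.X B.F (extremePart B.F Xs)) := by
  obtain ⟨κ, cell, hfin, hext⟩ := hB.exists_cell
  have hcell : B.IsCellular cell := ⟨hfin, hext⟩
  have hU : IsScenarioSet B.U U₀ := ⟨hU₀, hU₀ne, hU₀sub⟩
  have hW : IsScenarioSet (B.U ×ˢ B.U) W₀ := ⟨hW₀, hW₀ne, hW₀sub⟩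
  have hstep : ∀ {s s'}, B.StateInv s → B.MOAStep U₀ W₀ s s' →
      B.StateInv s' ∧ B.stateRank cell s' < B.stateRank cell s :=
    fun hs h => BROData.MOAStep.inv_and_rank_lt hB hcell hU hW hs h
  have hinv : ∀ s, Relation.ReflTransGen (B.MOAStep U₀ W₀) (.minFirst U₀) s → B.StateInv s := by
    intro s h
    induction h with
    | refl => exact hU
    | tail _ h ih => exact (hstep ih h).1
  refine ⟨?_, fun s hs => (hinv s hs).done_or_exists_step hB hcell,
    fun Xs Ys h => LoopInv.correct (hinv _ h)⟩
  rintro ⟨s, hs0, hs⟩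
  have hall : ∀ j, B.StateInv (s j) := fun j => by
    induction j with
    | zero => exact hs0 ▸ hU
    | succ j ih => exact (hstep ih (hs j)).1
  -- An infinite run would give an infinite descent in a well-founded lexicographic order.
  obtain ⟨j, hj⟩ :=
    WellFounded.not_rel_apply_succ (r := (· < ·)) fun j => B.stateRank cell (s j)
  exact hj (hstep (hall j) (hs j)).2
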